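/- Let $S$ be an oriented surface without boundary (not necessarily compact), with a locally finite triangulation $T$: a graph embedded in $S$ (loops and parallel edges allowed, every vertex of finite degree), each of whose faces is an open disk bounded by three sides of edges. Suppose that $T$ is reducing: every vertex has degree at least $8$, and the dual graph is bipartite, i.e. the triangles are coloured red and blue so that triangles sharing an edge have different colours. A walk of length $n\ge 0$ in $T$ is a sequence of $n$ consecutive directed edges (a walk of length $0$ is a single vertex). Suppose that a walk traverses a directed edge $e$, arrives at a vertex $v$, and leaves it along a directed edge $e'$. For $k\ge 0$, it makes a $k$-turn at $v$ if exactly $k$ triangles lie to its left in the cyclic order around $v$ between $e$ and $e'$; for $k\ge 1$, it makes a $-k$-turn at $v$ if exactly $k$ triangles lie to its right. A $k_r$-turn is a $k$-turn such that the triangle to the left of $e$ is red. The bad turns are the $0$-turns, $1$-turns, $-1$-turns, $2_r$-turns and $-2_r$-turns. A walk is reduced if it makes no bad turn at any of its interior vertices. Two walks with the same endpoints are homotopic if, as paths on $S$, they are homotopic with fixed endpoints. Then any two homotopic reduced walks in $T$ are equal. Moreover, every walk in $T$ is homotopic to a reduced walk; hence each homotopy class of walks contains exactly one reduced walk. -/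

import Mathlib

noncomputable section

/-- The two colours used for the triangles. -/
inductive TriangleColor where
  | red
  | blue

/-- The combinatorial data of a triangulation of an oriented surface without boundary, on a
set `D` of darts (directed edges).  Loops and parallel edges are allowed, the set of darts may be
infinite, but every vertex has finite degree. -/
structure OrientedTriangulation (D : Type*) where
  /-- The reversal of a dart; an edge is a pair `{d, rev d}`. -/
  rev : Equiv.Perm D
  rev_rev : ∀ d, rev (rev d) = d
  rev_ne : ∀ d, rev d ≠ d
  /-- The rotation system: `cw d` is the dart that follows `d` in clockwise order among the darts
  with the same source as `d`. -/
  cw : Equiv.Perm D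
  /-- Every vertex has finite degree. -/
  finite_cycle : ∀ d, {d' | cw.SameCycle d d'}.Finite
  /-- Every face is bounded by three sides of edges: the dart that follows `d` along the face to
  the left of `d` is `cw (rev d)`, and its orbits have exactly three elements. -/
  face_three : ∀ d, cw (rev (cw (rev (cw (rev d))))) = d
  face_ne : ∀ d, cw (rev d) ≠ d

namespace OrientedTriangulation

variable {D : Type*} (M : OrientedTriangulation D)

/-- The dart that follows `d` along the boundary of the triangle to the left of `d`. -/
def next (d : D) : D := M.cw (M.rev d)

/-- The vertices are the cycles of the rotation system. -/
def Vertex : Type _ := Quotient (Equiv.Perm.SameCycle.setoid M.cw)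

/-- The source of a dart. -/
def src (d : D) : M.Vertex := Quotient.mk (Equiv.Perm.SameCycle.setoid M.cw) d

/-- The target of a dart. -/
def tgt (d : D) : M.Vertex := M.src (M.rev d)

/-- The degree of a vertex: the number of darts that leave it (a loop counts twice). -/
def degree (v : M.Vertex) : ℕ := {d | M.src d = v}.ncard

/-- The directed edges from `u` to `v`. -/
instance instQuiverVertex : Quiver M.Vertex where
  Hom u v := {d : D // M.src d = u ∧ M.tgt d = v}

/-- A walk from `u` to `v` in the (undirected) graph: a finite, possibly empty, sequence of
consecutive directed edges. -/
abbrev Walk (u v : M.Vertex) : Type _ := Quiver.Path u v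

variable {M} in
/-- The sequence of darts that a walk traverses. -/
def Walk.darts {u v : M.Vertex} : M.Walk u v → List D
  | Quiver.Path.nil => []
  | Quiver.Path.cons p d => Walk.darts p ++ [d.1]

/-! ### Turns and reduced walks -/

/-- Going through `e` and then through `e'`, one makes a `k`-turn: for `k ≥ 0`, there are exactly
`k` triangles to the left, in the cyclic order around the middle vertex, between `e` and `e'`;
for `k < 0`, there are exactly `-k` triangles to the right.  (Arriving through `e`, the triangles
to the left are met by rotating clockwise from `rev e`.) -/
def IsTurn (k : ℤ) (e e' : D) : Prop :=
  k.natAbs < M.degree (M.tgt e) ∧ e' = (M.cw ^ k) (M.rev e)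

/-- `color d` is the colour of the triangle to the left of the dart `d`.  It depends on this
triangle only, and triangles that share an edge have different colours. -/
structure IsDualColoring (color : D → TriangleColor) : Prop where
  color_next : ∀ d, color (M.next d) = color d
  color_rev : ∀ d, color (M.rev d) ≠ color d

/-- A reducing triangulation, with its red/blue colouring. -/
structure IsReducing (color : D → TriangleColor) : Prop where
  coloring : M.IsDualColoring color
  eight_le_degree : ∀ v, 8 ≤ M.degree v

/-- The bad turns: `0`, `1`, `-1`, `2_r` and `-2_r`, where the index `r` means that the triangle to
the left of the first dart is red. -/
def IsBadTurn (color : D → TriangleColor) (e e' : D) : Prop :=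
  M.IsTurn 0 e e' ∨ M.IsTurn 1 e e' ∨ M.IsTurn (-1) e e' ∨
    (color e = TriangleColor.red ∧ (M.IsTurn 2 e e' ∨ M.IsTurn (-2) e e'))

variable {M} in
/-- A walk is reduced if none of its interior vertices makes a bad turn. -/
def Walk.IsReduced (color : D → TriangleColor) {u v : M.Vertex} (W : M.Walk u v) : Prop :=
  (Walk.darts W).IsChain fun e e' => ¬ M.IsBadTurn color e e'

/-! ### The surface obtained by gluing triangles -/

/-- Permutation of the barycentric coordinates of a triangle. -/
def permute (σ : Equiv.Perm (Fin 3)) (x : stdSimplex ℝ (Fin 3)) : stdSimplex ℝ (Fin 3) :=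
  ⟨fun i => x.1 (σ i), fun i => x.2.1 (σ i), by
    rw [Equiv.sum_comp σ x.1]; exact x.2.2⟩

/-- The gluing relation on the disjoint union of one closed triangle for each dart `d`, whose
vertices `0`, `1`, `2` are the source of `d`, the target of `d` and the third vertex of the
triangle to the left of `d`.  The three copies of a same triangle are identified, and so are
the sides that correspond to the darts `d` and `rev d`, with opposite directions. -/
inductive Glue : ((_ : D) × stdSimplex ℝ (Fin 3)) → ((_ : D) × stdSimplex ℝ (Fin 3)) → Prop
  | rotate (d : D) (x : stdSimplex ℝ (Fin 3)) :
      Glue ⟨d, x⟩ ⟨M.next d, permute (finRotate 3) x⟩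
  | edge (d : D) (x : stdSimplex ℝ (Fin 3)) (hx : x.1 2 = 0) :
      Glue ⟨d, x⟩ ⟨M.rev d, permute (Equiv.swap 0 1) x⟩

/-- The topological space obtained by gluing the triangles, with the quotient topology. -/
def Realization : Type _ := Quot M.Glue

instance instTopologicalSpaceRealization : TopologicalSpace M.Realization :=
  inferInstanceAs (TopologicalSpace (Quot M.Glue))

/-- The point of the realization with barycentric coordinates `x` in the triangle of `d`. -/
def toRealization (d : D) (x : stdSimplex ℝ (Fin 3)) : M.Realization := Quot.mk M.Glue ⟨d, x⟩

/-- The point with barycentric coordinates `(1 - t, t, 0)`. -/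
def sidePoint (t : unitInterval) : stdSimplex ℝ (Fin 3) :=
  ⟨![1 - (t : ℝ), t, 0], by
    intro i
    fin_cases i
    · exact sub_nonneg.2 t.2.2
    · exact t.2.1
    · exact le_rfl, by
    simp [Fin.sum_univ_three]⟩

theorem continuous_sidePoint : Continuous sidePoint := by
  refine Continuous.subtype_mk (continuous_pi fun i => ?_) _
  fin_cases i
  · exact continuous_const.sub continuous_subtype_val
  · exact continuous_subtype_val
  · exact continuous_const

theorem toRealization_rev (d : D) (t : unitInterval) :
    M.toRealization d (sidePoint t) = M.toRealization (M.rev d) (sidePoint (unitInterval.symm t)) := by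
  have h := Quot.sound (Glue.edge (M := M) d (sidePoint t) rfl)
  refine h.trans (congrArg (M.toRealization (M.rev d)) (Subtype.ext (funext fun i => ?_)))
  fin_cases i <;> simp [permute, sidePoint, Equiv.swap_apply_def]

theorem toRealization_next (d : D) :
    M.toRealization d (sidePoint 1) = M.toRealization (M.next d) (sidePoint 0) := by
  have h := Quot.sound (Glue.rotate (M := M) d (sidePoint 1))
  refine h.trans (congrArg (M.toRealization (M.next d)) (Subtype.ext (funext fun i => ?_)))
  fin_cases i <;> simp [permute, sidePoint]

theorem toRealization_cw (d : D) :
    M.toRealization (M.cw d) (sidePoint 0) = M.toRealization d (sidePoint 0) := by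
  rw [M.toRealization_rev d 0, unitInterval.symm_zero, M.toRealization_next, next, M.rev_rev]

theorem toRealization_zpow (k : ℤ) (d : D) :
    M.toRealization ((M.cw ^ k) d) (sidePoint 0) = M.toRealization d (sidePoint 0) := by
  induction k generalizing d with
  | zero => rfl
  | succ n ih => rw [zpow_add_one, Equiv.Perm.mul_apply, ih, toRealization_cw]
  | pred n ih =>
    rw [zpow_sub_one, Equiv.Perm.mul_apply, ih, ← M.toRealization_cw, Equiv.Perm.inv_def,
      Equiv.apply_symm_apply]

/-- The position of a vertex in the realization. -/
def vertexPoint (v : M.Vertex) : M.Realization :=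
  Quotient.lift (fun d => M.toRealization d (sidePoint 0)) (by
    rintro d _ ⟨k, rfl⟩
    exact (M.toRealization_zpow k d).symm) v

/-- A dart, seen as a path in the realization. -/
def dartPath (d : D) : Path (M.vertexPoint (M.src d)) (M.vertexPoint (M.tgt d)) where
  toFun t := M.toRealization d (sidePoint t)
  continuous_toFun :=
    continuous_quot_mk.comp (continuous_sigmaMk.comp continuous_sidePoint)
  source' := rfl
  target' := (M.toRealization_rev d 1).trans (by rw [unitInterval.symm_one]; rfl)

variable {M} in
/-- A walk, seen as a path in the realization. -/
def Walk.toPath {u v : M.Vertex} : M.Walk u v → Path (M.vertexPoint u) (M.vertexPoint v)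
  | Quiver.Path.nil => Path.refl _
  | Quiver.Path.cons p d =>
      (Walk.toPath p).trans ((M.dartPath d.1).cast
        (congrArg M.vertexPoint d.2.1.symm) (congrArg M.vertexPoint d.2.2.symm))

end OrientedTriangulation

/-- A triangulation of the oriented surface `S` (without boundary, not necessarily compact):
combinatorial data, and a homeomorphism from the glued triangles to `S`. -/
structure SurfaceTriangulation (D S : Type*) [TopologicalSpace S] extends
    OrientedTriangulation D where
  /-- The homeomorphism that carries the glued triangles onto the surface. -/
  homeo : toOrientedTriangulation.Realization ≃ₜ S

namespace SurfaceTriangulation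

variable {D S : Type*} [TopologicalSpace S] (T : SurfaceTriangulation D S)

/-- The position of a vertex on the surface. -/
def point (v : T.Vertex) : S := T.homeo (T.vertexPoint v)

/-- A walk of the triangulation, seen as a path on the surface. -/
def walkPath {u v : T.Vertex} (W : T.Walk u v) : Path (T.point u) (T.point v) :=
  (OrientedTriangulation.Walk.toPath W).map T.homeo.continuous

/-- Two walks are homotopic if they are so as paths on the surface, with fixed endpoints. -/
def Homotopic {u v : T.Vertex} (W₁ W₂ : T.Walk u v) : Prop :=
  Path.Homotopic (T.walkPath W₁) (T.walkPath W₂)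

end SurfaceTriangulation

end

/- The bad turns are the left-hand sides of a rewriting system on the words of darts, which pushes
the two darts of a bad turn across the triangles on its inner side. It terminates, because a step
shortens the word or replaces its first red dart by a blue one, and it is locally confluent, so that
each class of words modulo bad turns contains at most one reduced word. It remains to see that
homotopic walks have equivalent words. The words modulo bad turns form a group in which reversed
darts are inverse to each other and the product around each triangle is trivial; these relations are
those of a cocycle, so they define a covering of the surface with this group as group of deck
transformations. Lifting two homotopic walks to the covering shows that they end in the same sheet,
that is, that their words have the same class. -/

section Rewriting

variable {α β : Type*} {r : α → α → Prop}

open Relation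

theorem map_join_reflTransGen {s : β → β → Prop} (f : α → β) (hf : ∀ a b, r a b → s (f a) (f b))
    {a b : α} : Join (ReflTransGen r) a b → Join (ReflTransGen s) (f a) (f b) :=
  fun ⟨c, hac, hbc⟩ => ⟨f c, hac.lift f hf, hbc.lift f hf⟩

/- Newman's lemma, by induction on the source of the two reductions: the tips of their first steps
have a common reduct, and the induction hypothesis applies to each of the two tips. -/
theorem join_reflTransGen_of_locallyConfluent (hwf : WellFounded (flip r))
    (hloc : ∀ a b c, r a b → r a c → Join (ReflTransGen r) b c) {a b c : α}
    (hab : ReflTransGen r a b) (hac : ReflTransGen r a c) : Join (ReflTransGen r) b c := by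
  induction a using hwf.induction generalizing b c with
  | _ a ih =>
    rcases hab.cases_head with rfl | ⟨b', hab', hb'b⟩
    · exact ⟨c, hac, .refl⟩
    rcases hac.cases_head with rfl | ⟨c', hac', hc'c⟩
    · exact ⟨b, .refl, hab⟩
    obtain ⟨d, hb'd, hc'd⟩ := hloc a b' c' hab' hac'
    obtain ⟨e, hbe, hde⟩ := ih b' hab' hb'b hb'd
    obtain ⟨f, hef, hcf⟩ := ih c' hac' (hc'd.trans hde) hc'c
    exact ⟨f, hbe.trans hef, hcf⟩

theorem eq_of_eqvGen_of_irreducible (hwf : WellFounded (flip r))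
    (hloc : ∀ a b c, r a b → r a c → Join (ReflTransGen r) b c) {a b : α}
    (hab : EqvGen r a b) (ha : ∀ c, ¬ r a c) (hb : ∀ c, ¬ r b c) : a = b := by
  have hequiv : Equivalence (Join (ReflTransGen r)) :=
    equivalence_join fun _ _ _ => join_reflTransGen_of_locallyConfluent hwf hloc
  obtain ⟨c, hac, hbc⟩ : Join (ReflTransGen r) a b :=
    hequiv.eqvGen_iff.1 (hab.mono fun x y hxy => ⟨y, .single hxy, .refl⟩)
  rcases hac.cases_head with rfl | ⟨d, had, -⟩
  · rcases hbc.cases_head with rfl | ⟨d, hbd, -⟩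
    · rfl
    · exact absurd hbd (hb d)
  · exact absurd had (ha d)

theorem eqvGen_map {s : β → β → Prop} (f : α → β) (hf : ∀ a b, r a b → s (f a) (f b)) {a b : α}
    (h : EqvGen r a b) : EqvGen s (f a) (f b) :=
  Quot.eqvGen_exact (congrArg (Quot.map f hf) (Quot.eqvGen_sound h))

end Rewriting

section Lifting

variable {E X : Type*} [TopologicalSpace E] [TopologicalSpace X]

theorem target_eq_of_isCoveringMap_of_homotopic {p : E → X} (hp : IsCoveringMap p)
    {a b c : E} {x y : X} {α β : Path x y} (h : α.Homotopic β) (α' : Path a b) (β' : Path a c)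
    (hα : ∀ t, p (α' t) = α t) (hβ : ∀ t, p (β' t) = β t) : b = c := by
  have hα' : (ContinuousMap.comp ⟨p, hp.continuous⟩ α'.toContinuousMap) = α.toContinuousMap :=
    ContinuousMap.ext hα
  have hβ' : (ContinuousMap.comp ⟨p, hp.continuous⟩ β'.toContinuousMap) = β.toContinuousMap :=
    ContinuousMap.ext hβ
  obtain ⟨F⟩ := (hp.homotopicRel_iff_comp (S := {0, 1})
    ⟨0, .inl rfl, α'.source.trans β'.source.symm⟩).2 (by rw [hα', hβ']; exact h)
  exact α'.target.symm.trans ((F.fst_eq_snd (.inr rfl)).trans β'.target)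

end Lifting

section SimplyConnected

instance contractibleSpace_stdSimplex {ι : Type*} [Fintype ι] [Nonempty ι] :
    ContractibleSpace (stdSimplex ℝ ι) :=
  (convex_stdSimplex ℝ ι).contractibleSpace (Set.nonempty_coe_sort.1 inferInstance)

theorem trans_homotopic_of_simplyConnectedSpace {X Y : Type*} [TopologicalSpace X]
    [TopologicalSpace Y] [SimplyConnectedSpace Y] {f : Y → X} (hf : Continuous f) {y₀ y₁ y₂ : Y}
    (a : Path y₀ y₁) (b : Path y₁ y₂) (c : Path y₀ y₂) {x₀ x₁ x₂ : X} {p : Path x₀ x₁}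
    {q : Path x₁ x₂} {r : Path x₀ x₂} (hp : ∀ t, f (a t) = p t) (hq : ∀ t, f (b t) = q t)
    (hr : ∀ t, f (c t) = r t) : (p.trans q).Homotopic r := by
  obtain rfl : f y₀ = x₀ := by simpa using hp 0
  obtain rfl : f y₁ = x₁ := by simpa using hp 1
  obtain rfl : f y₂ = x₂ := by simpa using hq 1
  obtain rfl : a.map hf = p := Path.ext (funext hp)
  obtain rfl : b.map hf = q := Path.ext (funext hq)
  obtain rfl : c.map hf = r := Path.ext (funext hr)
  rw [← Path.map_trans]
  exact (SimplyConnectedSpace.paths_homotopic (a.trans b) c).map ⟨f, hf⟩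

end SimplyConnected

namespace OrientedTriangulation

section Darts

variable {D : Type*} (M : OrientedTriangulation D)

@[simp]
theorem rev_rev_apply (d : D) : M.rev (M.rev d) = d := M.rev_rev d

@[simp]
theorem next_next_next (d : D) : M.next (M.next (M.next d)) = d := M.face_three d

theorem next_ne (d : D) : M.next d ≠ d := M.face_ne d

theorem cw_apply (d : D) : M.cw d = M.next (M.rev d) := by simp only [next, rev_rev_apply]

theorem cw_zpow_two_apply (d : D) : (M.cw ^ (2 : ℤ)) d = M.next (M.rev (M.next (M.rev d))) := by
  rw [zpow_ofNat, pow_two, Equiv.Perm.mul_apply, cw_apply, cw_apply]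

theorem cw_zpow_neg_one_apply (d : D) : (M.cw ^ (-1 : ℤ)) d = M.rev (M.next (M.next d)) := by
  rw [zpow_neg_one, Equiv.Perm.inv_eq_iff_eq, cw_apply, rev_rev_apply, next_next_next]

theorem cw_zpow_neg_two_apply (d : D) :
    (M.cw ^ (-2 : ℤ)) d = M.rev (M.next (M.next (M.rev (M.next (M.next d))))) := by
  rw [show (-2 : ℤ) = -1 + -1 by rfl, zpow_add, Equiv.Perm.mul_apply, cw_zpow_neg_one_apply,
    cw_zpow_neg_one_apply]

theorem src_cw (d : D) : M.src (M.cw d) = M.src d :=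
  Quotient.sound ((Equiv.Perm.SameCycle.refl M.cw d).apply_left)

theorem src_next (d : D) : M.src (M.next d) = M.tgt d := M.src_cw (M.rev d)

theorem tgt_rev (d : D) : M.tgt (M.rev d) = M.src d := by rw [tgt, rev_rev_apply]

theorem tgt_next_next (d : D) : M.tgt (M.next (M.next d)) = M.src d := by
  rw [← src_next, next_next_next]

theorem degree_src (d : D) : M.degree (M.src d) = Function.minimalPeriod M.cw d := by
  have horbit : {d' | M.src d' = M.src d} = MulAction.orbit (Subgroup.zpowers M.cw) d := by
    ext d'
    refine Quotient.eq.trans ⟨fun h => ?_, ?_⟩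
    · obtain ⟨k, hk⟩ := h.symm
      exact ⟨⟨M.cw ^ k, k, rfl⟩, hk⟩
    · rintro ⟨⟨_, k, rfl⟩, rfl⟩
      exact (Equiv.Perm.SameCycle.refl M.cw d).zpow_left
  have : Finite (MulAction.orbit (Subgroup.zpowers M.cw) d) := by
    rw [← horbit]
    exact (M.finite_cycle d).subset fun d' h => (Quotient.exact h).symm
  have := Fintype.ofFinite (MulAction.orbit (Subgroup.zpowers M.cw) d)
  rw [degree, horbit, ← Nat.card_coe_set_eq, Nat.card_eq_fintype_card,
    ← MulAction.minimalPeriod_eq_card]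
  rfl

theorem eq_of_cw_zpow_apply_eq {d : D} {j k : ℤ} (hjk : (j - k).natAbs < M.degree (M.src d))
    (h : (M.cw ^ j) d = (M.cw ^ k) d) : j = k := by
  rw [degree_src] at hjk
  have hfix : M.cw ^ (j - k) • d = d := by
    rwa [sub_eq_neg_add, zpow_add, zpow_neg, mul_smul, inv_smul_eq_iff]
  rw [MulAction.zpow_smul_eq_iff_minimalPeriod_dvd] at hfix
  exact sub_eq_zero.1 (Int.eq_zero_of_dvd_of_natAbs_lt_natAbs hfix hjk)

end Darts

/-! ### The rewriting system of bad turns -/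

section Words

variable {D : Type*} {M : OrientedTriangulation D} {color : D → TriangleColor}

open Relation

theorem IsDualColoring.color_rev_eq_red_iff (hM : M.IsDualColoring color) (d : D) :
    color (M.rev d) = .red ↔ color d ≠ .red := by
  have := hM.color_rev d
  cases h : color d <;> cases h' : color (M.rev d) <;> simp_all

variable (M color) in
/-- `M.Shortcut color a b k m` means that `b` makes a bad `k`-turn after `a`, and that `m` is the
word obtained by pushing the two darts `a`, `b` across the triangles on the inner side of the turn.
The bound on `k` in `IsTurn` is left out, so that shortcuts make sense for all degrees. -/
inductive Shortcut (a b : D) : ℤ → List D → Prop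
  | spur (hb : b = M.rev a) : Shortcut a b 0 []
  | left (hb : b = M.next a) : Shortcut a b 1 [M.rev (M.next (M.next a))]
  | right (hb : b = M.rev (M.next (M.next (M.rev a)))) : Shortcut a b (-1) [M.next (M.rev a)]
  | flipLeft (ha : color a = .red) (hb : b = M.next (M.rev (M.next a))) :
      Shortcut a b 2
        [M.rev (M.next (M.next a)), M.rev (M.next (M.next (M.rev (M.next a))))]
  | flipRight (ha : color a = .red)
      (hb : b = M.rev (M.next (M.next (M.rev (M.next (M.next (M.rev a))))))) :
      Shortcut a b (-2) [M.next (M.rev a), M.next (M.rev (M.next (M.next (M.rev a))))]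

variable (M color) in
/-- One replacement of a bad turn inside a word of darts. -/
inductive Step : List D → List D → Prop
  | head {a b : D} {k : ℤ} {m : List D} (l : List D) (h : M.Shortcut color a b k m) :
      Step (a :: b :: l) (m ++ l)
  | cons (a : D) {l l' : List D} (h : Step l l') : Step (a :: l) (a :: l')

namespace Shortcut

variable {a b : D} {j k : ℤ} {m m' : List D}

theorem natAbs_le_two (h : M.Shortcut color a b k m) : k.natAbs ≤ 2 := by
  cases h <;> decide

theorem eq_cw_zpow (h : M.Shortcut color a b k m) : b = (M.cw ^ k) (M.rev a) := by
  cases h with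
  | spur hb => exact hb
  | left hb => exact hb
  | right hb => rwa [cw_zpow_neg_one_apply]
  | flipLeft _ hb => rwa [cw_zpow_two_apply, rev_rev_apply]
  | flipRight _ hb => rwa [cw_zpow_neg_two_apply]

theorem isBadTurn (h : M.Shortcut color a b k m) (hdeg : 3 ≤ M.degree (M.tgt a)) :
    M.IsBadTurn color a b := by
  have hk : M.IsTurn k a b := ⟨h.natAbs_le_two.trans_lt hdeg, h.eq_cw_zpow⟩
  cases h with
  | spur => exact .inl hk
  | left => exact .inr (.inl hk)
  | right => exact .inr (.inr (.inl hk))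
  | flipLeft ha => exact .inr (.inr (.inr ⟨ha, .inl hk⟩))
  | flipRight ha => exact .inr (.inr (.inr ⟨ha, .inr hk⟩))

theorem unique (hdeg : 5 ≤ M.degree (M.tgt a)) (h : M.Shortcut color a b j m)
    (h' : M.Shortcut color a b k m') : m = m' := by
  obtain rfl : j = k := by
    refine M.eq_of_cw_zpow_apply_eq (d := M.rev a) ?_ (h.eq_cw_zpow.symm.trans h'.eq_cw_zpow)
    calc (j - k).natAbs ≤ j.natAbs + k.natAbs := Int.natAbs_sub_le j k
      _ ≤ 2 + 2 := add_le_add h.natAbs_le_two h'.natAbs_le_two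
      _ < M.degree (M.tgt a) := hdeg
  cases h <;> cases h' <;> rfl

end Shortcut

theorem IsBadTurn.exists_shortcut {a b : D} (h : M.IsBadTurn color a b) :
    ∃ k m, M.Shortcut color a b k m := by
  obtain ⟨-, hb⟩ | ⟨-, hb⟩ | ⟨-, hb⟩ | ⟨ha, ⟨-, hb⟩ | ⟨-, hb⟩⟩ := h
  · exact ⟨_, _, .spur hb⟩
  · exact ⟨_, _, .left hb⟩
  · exact ⟨_, _, .right (by rwa [cw_zpow_neg_one_apply] at hb)⟩
  · exact ⟨_, _, .flipLeft ha (by rwa [cw_zpow_two_apply, rev_rev_apply] at hb)⟩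
  · exact ⟨_, _, .flipRight ha (by rwa [cw_zpow_neg_two_apply] at hb)⟩

namespace Step

variable {l l' : List D}

theorem append_right (h : M.Step color l l') (k : List D) : M.Step color (l ++ k) (l' ++ k) := by
  induction h with
  | head l h => simpa only [List.cons_append, List.append_assoc] using head (l ++ k) h
  | cons a _ ih => exact ih.cons a

theorem append_left (h : M.Step color l l') (k : List D) : M.Step color (k ++ l) (k ++ l') := by
  induction k with
  | nil => exact h
  | cons a k ih => exact ih.cons a

end Step

theorem isChain_not_shortcut_iff (l : List D) :
    (l.IsChain fun a b => ¬ ∃ k m, M.Shortcut color a b k m) ↔ ∀ l', ¬ M.Step color l l' := by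
  induction l with
  | nil => exact ⟨fun _ _ h => (by cases h), fun _ => .nil⟩
  | cons a l ih =>
    cases l with
    | nil => exact ⟨fun _ _ h => (by cases h with | cons _ h => cases h), fun _ => .singleton _⟩
    | cons b l =>
      rw [List.isChain_cons_cons, ih]
      constructor
      · rintro ⟨hab, hl⟩ _ (⟨_, h⟩ | ⟨_, h⟩)
        · exact hab ⟨_, _, h⟩
        · exact hl _ h
      · exact fun h => ⟨fun ⟨_, _, hab⟩ => h _ (.head l hab), fun _ hl => h _ (hl.cons a)⟩

/-- The order on words that decreases along steps: shorter words come first, and words of the same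
length are compared lexicographically, red darts (those with a red triangle on their left) being
larger than the other ones. -/
def redShortlex (color : D → TriangleColor) : List D → List D → Prop :=
  List.Shortlex fun a b => color a ≠ .red ∧ color b = .red

theorem redShortlex_wellFounded : WellFounded (redShortlex color) :=
  List.Shortlex.wf ⟨fun _ => ⟨_, fun _ h => ⟨_, fun _ h' => absurd h'.2 h.1⟩⟩⟩

theorem Step.redShortlex (hM : M.IsDualColoring color) {l l' : List D} (h : M.Step color l l') :
    redShortlex color l' l := by
  induction h with
  | head l h =>
    cases h with
    | spur | left | right => exact .of_length_lt (by simp)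
    | flipLeft ha | flipRight ha =>
      exact .of_lex rfl (.rel (by simp [hM.color_next, hM.color_rev_eq_red_iff, ha]))
  | cons a _ ih =>
    have : Std.Irrefl fun a b => color a ≠ .red ∧ color b = .red := ⟨fun _ h => h.1 h.2⟩
    exact List.shortlex_cons_iff.2 ih

theorem Step.wellFounded (hM : M.IsDualColoring color) : WellFounded (flip (M.Step color)) :=
  Subrelation.wf (fun h => h.redShortlex hM) redShortlex_wellFounded

end Words

section Confluence

variable {D : Type*} {M : OrientedTriangulation D} {color : D → TriangleColor}

open Relation

namespace Shortcut

variable {a b c : D} {j k : ℤ} {m m' : List D}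

theorem step (h : M.Shortcut color a b k m) : M.Step color [a, b] m := by
  simpa only [List.append_nil] using Step.head [] h

theorem reflTransGen_of_spur_left (h : M.Shortcut color (M.rev a) c k m) :
    ReflTransGen (M.Step color) (a :: m) [c] := by
  cases h with
  | spur hb => simpa [hb] using ReflTransGen.refl
  | left hb =>
    subst hb
    exact .single (right rfl).step
  | right hb =>
    subst hb
    simpa using ReflTransGen.single (left rfl).step
  | flipLeft _ hb =>
    subst hb
    exact .head (.head _ (.right rfl)) (.single (right rfl).step)
  | flipRight _ hb =>
    subst hb
    simp only [rev_rev_apply]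
    exact .head (.head _ (.left rfl)) (.single (left rfl).step)

theorem step_rev_next_next_rev_next (a : D) :
    M.Step color [M.rev (M.next (M.next a)), M.rev (M.next a)] [a] := by
  simpa using (right (M := M) (color := color) (a := M.rev (M.next (M.next a))) rfl).step

theorem step_next_rev_next_next_rev (a : D) :
    M.Step color [M.next (M.rev a), M.next (M.next (M.rev a))] [a] := by
  simpa using (left (M := M) (color := color) (a := M.next (M.rev a)) rfl).step

theorem reflTransGen_of_spur_right (h : M.Shortcut color a b k m) :
    ReflTransGen (M.Step color) (m ++ [M.rev b]) [a] := by
  cases h with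
  | spur hb => simpa [hb] using ReflTransGen.refl
  | left hb =>
    subst hb
    exact .single (step_rev_next_next_rev_next a)
  | right hb =>
    subst hb
    simpa using ReflTransGen.single (step_next_rev_next_next_rev a)
  | flipLeft _ hb =>
    subst hb
    exact .head ((step_rev_next_next_rev_next _).cons _) (.single (step_rev_next_next_rev_next a))
  | flipRight _ hb =>
    subst hb
    simp only [rev_rev_apply]
    refine .head (.cons _ ?_) (.single (step_next_rev_next_next_rev a))
    simpa using step_next_rev_next_next_rev (M := M) (color := color) (M.next (M.next (M.rev a)))

theorem join_left (hM : M.IsDualColoring color) (h : M.Shortcut color (M.next a) c k m) :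
    Join (ReflTransGen (M.Step color)) [M.rev (M.next (M.next a)), c] (a :: m) := by
  cases h with
  | spur hc =>
    subst hc
    exact ⟨_, reflTransGen_of_spur_right (left rfl), .refl⟩
  | left hc =>
    subst hc
    exact ⟨[], .single (spur (by simp)).step, .single (spur (by simp)).step⟩
  | right hc =>
    subst hc
    by_cases ha : color a = .red
    · exact ⟨_, .refl, .single (flipLeft ha rfl).step⟩
    · refine ⟨_, .single (flipRight ?_ ?_).step, ?_⟩
      · simpa [hM.color_next, hM.color_rev_eq_red_iff] using ha
      · simp
      · simpa using ReflTransGen.refl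
  | flipLeft _ hc =>
    subst hc
    refine ⟨_, .single (left rfl).step, .single ?_⟩
    simpa using Step.head _ (Shortcut.spur rfl)
  | flipRight ha hc =>
    subst hc
    rw [hM.color_next] at ha
    exact ⟨_, .refl, .head (.head _ (.flipLeft ha rfl)) (.single ((left rfl).step.cons _))⟩

theorem join_right (hM : M.IsDualColoring color)
    (h : M.Shortcut color (M.rev (M.next (M.next (M.rev a)))) c k m) :
    Join (ReflTransGen (M.Step color)) [M.next (M.rev a), c] (a :: m) := by
  cases h with
  | spur hc =>
    subst hc
    exact ⟨_, reflTransGen_of_spur_right (right rfl), .refl⟩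
  | left hc =>
    subst hc
    by_cases ha : color a = .red
    · exact ⟨_, .refl, .single (flipRight ha rfl).step⟩
    · refine ⟨_, .single (flipLeft ?_ rfl).step, ?_⟩
      · simpa [hM.color_next, hM.color_rev_eq_red_iff] using ha
      · simpa using ReflTransGen.refl
  | right hc =>
    subst hc
    exact ⟨[], .single (spur (by simp)).step, .single (spur (by simp)).step⟩
  | flipLeft ha hc =>
    subst hc
    have ha' : color a = .red := by
      simpa [hM.color_next, hM.color_rev_eq_red_iff] using ha
    exact ⟨_, .refl, .head (.head _ (.flipRight ha' rfl)) (.single ((right rfl).step.cons _))⟩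
  | flipRight _ hc =>
    subst hc
    simp only [rev_rev_apply, next_next_next]
    exact ⟨_, .single (right rfl).step, .single (.head _ (.spur rfl))⟩

/- The second dart of a flipped turn has a blue triangle on its left, so it starts no flip. -/
theorem join_flipLeft (hM : M.IsDualColoring color) (ha : color a = .red)
    (h : M.Shortcut color (M.next (M.rev (M.next a))) c k m) :
    Join (ReflTransGen (M.Step color))
      [M.rev (M.next (M.next a)), M.rev (M.next (M.next (M.rev (M.next a)))), c] (a :: m) := by
  cases h with
  | spur hc =>
    subst hc
    exact ⟨_, reflTransGen_of_spur_right (flipLeft ha rfl), .refl⟩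
  | left hc =>
    subst hc
    simp only [rev_rev_apply, next_next_next]
    exact ⟨_, .single ((spur (by simp)).step.cons _), .single (left rfl).step⟩
  | right hc =>
    subst hc
    refine ⟨_, .head ((flipRight ?_ ?_).step.cons _) (.single ?_), .refl⟩
    · simp [hM.color_next, hM.color_rev_eq_red_iff, ha]
    · simp
    · simpa using (step_rev_next_next_rev_next a).append_right _
  | flipLeft hb | flipRight hb =>
    simp [hM.color_next, hM.color_rev_eq_red_iff, ha] at hb

theorem join_flipRight (hM : M.IsDualColoring color) (ha : color a = .red)
    (h : M.Shortcut color (M.rev (M.next (M.next (M.rev (M.next (M.next (M.rev a))))))) c k m) :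
    Join (ReflTransGen (M.Step color))
      [M.next (M.rev a), M.next (M.rev (M.next (M.next (M.rev a)))), c] (a :: m) := by
  cases h with
  | spur hc =>
    subst hc
    exact ⟨_, reflTransGen_of_spur_right (flipRight ha rfl), .refl⟩
  | left hc =>
    subst hc
    refine ⟨_, .head ((flipLeft ?_ rfl).step.cons _) (.single ?_), .refl⟩
    · simp [hM.color_next, hM.color_rev_eq_red_iff, ha]
    · simpa using (step_next_rev_next_next_rev a).append_right _
  | right hc =>
    subst hc
    simp only [rev_rev_apply, next_next_next]
    exact ⟨_, .single ((spur (by simp)).step.cons _), .single (right rfl).step⟩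
  | flipLeft hb | flipRight hb =>
    simp [hM.color_next, hM.color_rev_eq_red_iff, ha] at hb

theorem join (hM : M.IsDualColoring color) (h : M.Shortcut color a b j m)
    (h' : M.Shortcut color b c k m') :
    Join (ReflTransGen (M.Step color)) (m ++ [c]) (a :: m') := by
  cases h with
  | spur hb => exact ⟨_, .refl, reflTransGen_of_spur_left (hb ▸ h')⟩
  | left hb => exact join_left hM (hb ▸ h')
  | right hb => exact join_right hM (hb ▸ h')
  | flipLeft ha hb => exact join_flipLeft hM ha (hb ▸ h')
  | flipRight ha hb => exact join_flipRight hM ha (hb ▸ h')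

theorem join_step (hM : M.IsDualColoring color) (h : M.Shortcut color a b k m) {l l' : List D}
    (hl : M.Step color (b :: l) l') :
    Join (ReflTransGen (M.Step color)) (m ++ l) (a :: l') := by
  cases hl with
  | head l h' =>
    simpa using map_join_reflTransGen (· ++ l) (fun _ _ hs => hs.append_right l) (h.join hM h')
  | cons _ hl => exact ⟨_, .single (hl.append_left m), .single (.head _ h)⟩

end Shortcut

theorem Step.locallyConfluent (hM : M.IsDualColoring color) (hdeg : ∀ v, 5 ≤ M.degree v)
    (l l₁ l₂ : List D) (h₁ : M.Step color l l₁) (h₂ : M.Step color l l₂) :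
    Join (ReflTransGen (M.Step color)) l₁ l₂ := by
  induction h₁ generalizing l₂ with
  | head l h =>
    cases h₂ with
    | head _ h' => exact h.unique (hdeg _) h' ▸ ⟨_, .refl, .refl⟩
    | cons _ h' => exact h.join_step hM h'
  | cons a h ih =>
    cases h₂ with
    | head l h' =>
      obtain ⟨l', h₂, h₁⟩ := h'.join_step hM h
      exact ⟨l', h₁, h₂⟩
    | cons _ h' => exact map_join_reflTransGen _ (fun _ _ hs => hs.cons a) (ih _ h')

end Confluence

/-! ### Cocycles and their coverings -/

section Cocycles

variable {D : Type*} (M : OrientedTriangulation D)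

open Relation

/-- A cocycle with values in a group: an assignment of group elements to the darts, compatible with
reversal and with triangles. It is a representation of the homotopy classes of walks. -/
structure Cocycle (G : Type*) [Group G] where
  toFun : D → G
  map_rev : ∀ d, toFun (M.rev d) = (toFun d)⁻¹
  map_face : ∀ d, toFun d * toFun (M.next d) * toFun (M.next (M.next d)) = 1

instance {G : Type*} [Group G] : CoeFun (M.Cocycle G) fun _ => D → G := ⟨Cocycle.toFun⟩

/-- The congruence on words of darts that is generated by the replacements of bad turns. -/
def stepCon (color : D → TriangleColor) : Con (FreeMonoid D) where
  r w w' := EqvGen (M.Step color) w.toList w'.toList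
  iseqv := (EqvGen.is_equivalence _).comap FreeMonoid.toList
  mul' {w x y z} hwx hyz := by
    have hright := eqvGen_map (· ++ y.toList) (fun _ _ h => Step.append_right h _) hwx
    have hleft := eqvGen_map (x.toList ++ ·) (fun _ _ h => Step.append_left h _) hyz
    simpa only [FreeMonoid.toList_mul] using hright.trans _ _ _ hleft

variable (color : D → TriangleColor)

/-- The class of a dart modulo the replacements of bad turns, which is invertible because of the
`0`-turns. -/
def dartUnit (d : D) : (M.stepCon color).Quotientˣ where
  val := FreeMonoid.of d
  inv := FreeMonoid.of (M.rev d)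
  val_inv := (Con.eq _).2 (.rel _ _ (Shortcut.spur rfl).step)
  inv_val := (Con.eq _).2 (.rel _ _ (Shortcut.spur (M.rev_rev d).symm).step)

/-- The cocycle with values in the group of words of darts modulo the replacements of bad turns. -/
def universalCocycle : M.Cocycle (M.stepCon color).Quotientˣ where
  toFun := M.dartUnit color
  map_rev _ := Units.ext rfl
  map_face d := by
    have hleft : M.dartUnit color d * M.dartUnit color (M.next d) =
        M.dartUnit color (M.rev (M.next (M.next d))) :=
      Units.ext ((Con.eq _).2 (.rel _ _ (Shortcut.left rfl).step))
    rw [hleft, show M.dartUnit color (M.rev (M.next (M.next d))) =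
      (M.dartUnit color (M.next (M.next d)))⁻¹ from Units.ext rfl, inv_mul_cancel]

theorem coe_prod_map_universalCocycle (l : List D) :
    ((l.map (M.universalCocycle color)).prod : (M.stepCon color).Quotient) =
      (FreeMonoid.ofList l : FreeMonoid D) := by
  induction l with
  | nil => rfl
  | cons a l ih => rw [List.map_cons, List.prod_cons, Units.val_mul, ih]; rfl

theorem prod_map_universalCocycle_eq_iff {l l' : List D} :
    (l.map (M.universalCocycle color)).prod = (l'.map (M.universalCocycle color)).prod ↔
      EqvGen (M.Step color) l l' := by
  rw [← Units.val_inj, coe_prod_map_universalCocycle, coe_prod_map_universalCocycle]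
  exact Con.eq _

end Cocycles

section Realization

variable {D : Type*} {M : OrientedTriangulation D}

open Topology

theorem toRealization_rotate (d : D) (x : stdSimplex ℝ (Fin 3)) :
    M.toRealization d x = M.toRealization (M.next d) (permute (finRotate 3) x) :=
  Quot.sound (.rotate d x)

theorem toRealization_edge (d : D) {x : stdSimplex ℝ (Fin 3)} (hx : x.1 2 = 0) :
    M.toRealization d x = M.toRealization (M.rev d) (permute (Equiv.swap 0 1) x) :=
  Quot.sound (.edge d x hx)

variable (M) in
theorem continuous_toRealization (d : D) : Continuous (M.toRealization d) :=
  continuous_quot_mk.comp continuous_sigmaMk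

theorem continuous_coord (i : Fin 3) : Continuous fun x : stdSimplex ℝ (Fin 3) => x.1 i :=
  (continuous_apply i).comp continuous_subtype_val

theorem continuous_permute (σ : Equiv.Perm (Fin 3)) : Continuous (permute σ) :=
  Continuous.subtype_mk (continuous_pi fun i => continuous_coord (σ i)) _

theorem coord_sum (x : stdSimplex ℝ (Fin 3)) : x.1 0 + x.1 1 + x.1 2 = 1 := by
  rw [← Fin.sum_univ_three]
  exact x.2.2

theorem permute_finRotate_coord (x : stdSimplex ℝ (Fin 3)) :
    (permute (finRotate 3) x).1 0 = x.1 1 ∧ (permute (finRotate 3) x).1 1 = x.1 2 ∧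
      (permute (finRotate 3) x).1 2 = x.1 0 := by
  simp [permute]

theorem permute_swap_coord (x : stdSimplex ℝ (Fin 3)) :
    (permute (Equiv.swap 0 1) x).1 0 = x.1 1 ∧ (permute (Equiv.swap 0 1) x).1 1 = x.1 0 ∧
      (permute (Equiv.swap 0 1) x).1 2 = x.1 2 := by
  simp [permute, Equiv.swap_apply_def]

@[simp]
theorem permute_finRotate_three (x : stdSimplex ℝ (Fin 3)) :
    permute (finRotate 3) (permute (finRotate 3) (permute (finRotate 3) x)) = x := by
  refine Subtype.ext (funext fun i => ?_)
  fin_cases i <;> rfl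

namespace Realization

@[elab_as_elim]
theorem ind {p : M.Realization → Prop} (h : ∀ d x, p (M.toRealization d x)) (q : M.Realization) :
    p q :=
  Quot.ind (fun y => h y.1 y.2) q

theorem continuous_iff {X : Type*} [TopologicalSpace X] {f : M.Realization → X} :
    Continuous f ↔ ∀ d, Continuous fun x => f (M.toRealization d x) := by
  rw [show Continuous f ↔ _ from isQuotientMap_quot_mk.continuous_iff, continuous_sigma_iff]
  rfl

theorem isOpen_iff {U : Set M.Realization} :
    IsOpen U ↔ ∀ d, IsOpen (M.toRealization d ⁻¹' U) := by
  rw [show IsOpen U ↔ _ from isQuotientMap_quot_mk.isOpen_preimage.symm, isOpen_sigma_iff]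
  rfl

/-- The function on the realization that is given by `f d` on the triangle of `d`. -/
def lift {X : Type*} (f : D → stdSimplex ℝ (Fin 3) → X)
    (hrotate : ∀ d x, f d x = f (M.next d) (permute (finRotate 3) x))
    (hedge : ∀ d x, x.1 2 = 0 → f d x = f (M.rev d) (permute (Equiv.swap 0 1) x)) :
    M.Realization → X :=
  Quot.lift (fun y => f y.1 y.2) fun _ _ h => by
    cases h with
    | rotate d x => exact hrotate d x
    | edge d x hx => exact hedge d x hx

/-- The simplicial map induced by a map of darts that is compatible with the triangulations. -/
def map {E : Type*} {N : OrientedTriangulation E} (f : D → E)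
    (hnext : ∀ d, f (M.next d) = N.next (f d)) (hrev : ∀ d, f (M.rev d) = N.rev (f d)) :
    M.Realization → N.Realization :=
  lift (fun d => N.toRealization (f d)) (fun d x => by rw [hnext]; exact toRealization_rotate _ x)
    fun d _ hx => by rw [hrev]; exact toRealization_edge _ hx

theorem continuous_map {E : Type*} {N : OrientedTriangulation E} (f : D → E)
    (hnext : ∀ d, f (M.next d) = N.next (f d)) (hrev : ∀ d, f (M.rev d) = N.rev (f d)) :
    Continuous (map f hnext hrev) :=
  continuous_iff.2 fun d => N.continuous_toRealization (f d)

theorem exists_forall_pos_or_eq_zero (q : M.Realization) :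
    ∃ d x, M.toRealization d x = q ∧ ((∀ i, 0 < x.1 i) ∨ x.1 2 = 0) := by
  induction q using ind with | _ d x => ?_
  by_cases h2 : x.1 2 = 0
  · exact ⟨d, x, rfl, .inr h2⟩
  by_cases h0 : x.1 0 = 0
  · exact ⟨_, _, (toRealization_rotate d x).symm, .inr (by rwa [(permute_finRotate_coord x).2.2])⟩
  by_cases h1 : x.1 1 = 0
  · refine ⟨_, _, ((toRealization_rotate d x).trans (toRealization_rotate _ _)).symm, .inr ?_⟩
    rwa [(permute_finRotate_coord _).2.2, (permute_finRotate_coord x).1]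
  · refine ⟨d, x, rfl, .inl fun i => (x.2.1 i).lt_of_ne' ?_⟩
    fin_cases i <;> assumption

end Realization

end Realization

section Cover

variable {D : Type*} {M : OrientedTriangulation D} {G : Type*} [Group G]

open Topology

/-- The condition that some rotation of the triangle of `d` brings the point with coordinates `x`
to one that satisfies `P`. It depends only on the point of the triangle, not on the choice of
one of the three darts around it. -/
def rotationHull (P : D → Set (stdSimplex ℝ (Fin 3))) (d : D) : Set (stdSimplex ℝ (Fin 3)) :=
  {x | x ∈ P d ∨ permute (finRotate 3) x ∈ P (M.next d) ∨
    permute (finRotate 3) (permute (finRotate 3) x) ∈ P (M.next (M.next d))}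

theorem permute_finRotate_mem_rotationHull {P : D → Set (stdSimplex ℝ (Fin 3))} {d : D}
    {x : stdSimplex ℝ (Fin 3)} :
    permute (finRotate 3) x ∈ M.rotationHull P (M.next d) ↔ x ∈ M.rotationHull P d := by
  simp only [rotationHull, Set.mem_ofPred_eq, next_next_next, permute_finRotate_three]
  tauto

theorem isOpen_rotationHull {P : D → Set (stdSimplex ℝ (Fin 3))} (hP : ∀ d, IsOpen (P d)) (d : D) :
    IsOpen (M.rotationHull P d) :=
  (hP d).union <| ((hP _).preimage (continuous_permute _)).union <|
    (hP _).preimage ((continuous_permute _).comp (continuous_permute _))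

/-- The set of the points of the realization that satisfy `P` in one of their triangles. -/
def region (P : D → Set (stdSimplex ℝ (Fin 3)))
    (hP : ∀ d x, x.1 2 = 0 → (x ∈ M.rotationHull P d ↔
      permute (Equiv.swap 0 1) x ∈ M.rotationHull P (M.rev d))) : Set M.Realization :=
  Realization.lift (fun d x => x ∈ M.rotationHull P d)
    (fun _ _ => propext permute_finRotate_mem_rotationHull.symm) fun d x hx => propext (hP d x hx)

namespace Cocycle

variable (φ : M.Cocycle G)

@[simp]
theorem map_mul_rev (g : G) (d : D) : g * φ d * φ (M.rev d) = g := by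
  rw [φ.map_rev, mul_inv_cancel_right]

@[simp]
theorem mul_map_face (g : G) (d : D) :
    g * φ d * φ (M.next d) * φ (M.next (M.next d)) = g := by
  rw [mul_assoc, mul_assoc, ← mul_assoc (φ d), φ.map_face, mul_one]

theorem prodCongr_refl_zpow_apply {G : Type*} (σ : Equiv.Perm D) (k : ℤ) (d : D) (g : G) :
    ((σ.prodCongr (Equiv.refl G) : Equiv.Perm (D × G)) ^ k) (d, g) = ((σ ^ k) d, g) := by
  induction k generalizing d with
  | zero => rfl
  | succ n ih =>
    rw [zpow_add_one, zpow_add_one, Equiv.Perm.mul_apply, Equiv.Perm.mul_apply, ← ih]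
    rfl
  | pred n ih =>
    rw [zpow_sub_one, zpow_sub_one, Equiv.Perm.mul_apply, Equiv.Perm.mul_apply, ← ih]
    rfl

/-- The covering of the triangulation on which the cocycle becomes a coboundary. Its sheets are
indexed by the group, and crossing the dart `d` multiplies the index of the sheet by `φ d`. The
second component of a dart is the sheet of its source. -/
def cover : OrientedTriangulation (D × G) where
  rev := Function.Involutive.toPerm (fun e => (M.rev e.1, e.2 * φ e.1))
    fun e => Prod.ext (M.rev_rev e.1) (φ.map_mul_rev e.2 e.1)
  rev_rev e := Prod.ext (M.rev_rev e.1) (φ.map_mul_rev e.2 e.1)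
  rev_ne e h := M.rev_ne e.1 (congrArg Prod.fst h)
  cw := M.cw.prodCongr (Equiv.refl G)
  finite_cycle e := by
    refine ((M.finite_cycle e.1).image fun d => (d, e.2)).subset ?_
    rintro _ ⟨k, rfl⟩
    exact ⟨(M.cw ^ k) e.1, ⟨k, rfl⟩, (prodCongr_refl_zpow_apply M.cw k e.1 e.2).symm⟩
  face_three e := Prod.ext (M.face_three e.1) (φ.mul_map_face e.2 e.1)
  face_ne e h := M.face_ne e.1 (congrArg Prod.fst h)

theorem cover_rev (e : D × G) : φ.cover.rev e = (M.rev e.1, e.2 * φ e.1) := rfl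

theorem cover_next (e : D × G) : φ.cover.next e = (M.next e.1, e.2 * φ e.1) := rfl

/-- The vertex of the covering that lies over `u` in the sheet `g`. -/
def coverVertex (u : M.Vertex) (g : G) : φ.cover.Vertex :=
  Quotient.map' (fun d => (d, g)) (by
    rintro d _ ⟨k, rfl⟩
    exact ⟨k, prodCongr_refl_zpow_apply M.cw k d g⟩) u

theorem src_cover (d : D) (g : G) : φ.cover.src (d, g) = φ.coverVertex (M.src d) g := rfl

theorem tgt_cover (d : D) (g : G) :
    φ.cover.tgt (d, g) = φ.coverVertex (M.tgt d) (g * φ d) := rfl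

/-- The projection of the covering. -/
def proj : φ.cover.Realization → M.Realization :=
  Realization.map Prod.fst (fun _ => rfl) fun _ => rfl

theorem continuous_proj : Continuous φ.proj := Realization.continuous_map ..

/-- The deck transformations of the covering: the group acts on the indices of the sheets by
multiplication on the left. -/
instance : MulAction G φ.cover.Realization where
  smul g := Realization.map (fun e => (e.1, g * e.2))
    (fun _ => Prod.ext rfl (mul_assoc ..).symm) fun _ => Prod.ext rfl (mul_assoc ..).symm
  one_smul := Realization.ind fun e x =>
    congrArg (fun k => φ.cover.toRealization (e.1, k) x) (one_mul e.2)
  mul_smul g h := Realization.ind fun e x =>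
    congrArg (fun k => φ.cover.toRealization (e.1, k) x) (mul_assoc g h e.2)

instance : ContinuousConstSMul G φ.cover.Realization where
  continuous_const_smul _ := Realization.continuous_map ..

theorem smul_toRealization (g : G) (d : D) (h : G) (x : stdSimplex ℝ (Fin 3)) :
    g • φ.cover.toRealization (d, h) x = φ.cover.toRealization (d, g * h) x := rfl

theorem smul_vertexPoint (g : G) (u : M.Vertex) (h : G) :
    g • φ.cover.vertexPoint (φ.coverVertex u h) = φ.cover.vertexPoint (φ.coverVertex u (g * h)) :=
  Quotient.inductionOn u fun _ => rfl

theorem isQuotientMap_proj : IsQuotientMap φ.proj := by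
  refine (isQuotientMap_iff _).2 ⟨isCoinducing_iff.2 fun U => ?_, fun q => ?_⟩
  · refine ⟨fun hU => Realization.isOpen_iff.2 fun d => ?_, fun hU => hU.preimage φ.continuous_proj⟩
    exact Realization.isOpen_iff.1 hU (d, 1)
  · induction q using Realization.ind with | _ d x => exact ⟨φ.cover.toRealization (d, 1) x, rfl⟩

theorem smul_toRealization_one (e : D × G) (x : stdSimplex ℝ (Fin 3)) :
    e.2 • φ.cover.toRealization (e.1, 1) x = φ.cover.toRealization e x := by
  rw [smul_toRealization, mul_one]

/-- The orbit that lies over a point: the inverse of the map that the projection induces on the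
orbits. -/
def toOrbit : M.Realization → MulAction.orbitRel.Quotient G φ.cover.Realization :=
  Realization.lift (fun d x => Quotient.mk'' (φ.cover.toRealization (d, 1) x))
    (fun d x => Quotient.eq''.2 ⟨φ d, by
      beta_reduce
      rw [toRealization_rotate (d, 1), smul_toRealization, mul_one, cover_next, one_mul]⟩)
    fun d x hx => Quotient.eq''.2 ⟨φ d, by
      beta_reduce
      rw [toRealization_edge (d, 1) hx, smul_toRealization, mul_one, cover_rev, one_mul]⟩

theorem toOrbit_proj (p : φ.cover.Realization) : φ.toOrbit (φ.proj p) = Quotient.mk'' p := by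
  induction p using Realization.ind with | _ e x => ?_
  refine (Quotient.eq''.2 ?_).symm
  exact ⟨e.2, φ.smul_toRealization_one e x⟩

theorem proj_eq_proj_iff {p q : φ.cover.Realization} :
    φ.proj p = φ.proj q ↔ p ∈ MulAction.orbit G q := by
  refine ⟨fun h => MulAction.orbitRel_apply.1 (Quotient.eq''.1 ?_), ?_⟩
  · rw [← toOrbit_proj, ← toOrbit_proj, h]
  · rintro ⟨g, rfl⟩
    induction q using Realization.ind with | _ e x => rfl

section Disjoint

variable {P : D × G → Set (stdSimplex ℝ (Fin 3))}

theorem eq_of_mem_rotationHull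
    (hfree : ∀ e e' x, e.1 = e'.1 → x ∈ P e → x ∈ P e' → e = e')
    (hexcl : ∀ e e' x, e.1 = e'.1 → x ∈ P e → permute (finRotate 3) x ∉ P (φ.cover.next e'))
    {e e' : D × G} {x : stdSimplex ℝ (Fin 3)} (hee' : e.1 = e'.1)
    (hx : x ∈ φ.cover.rotationHull P e) (hx' : x ∈ φ.cover.rotationHull P e') : e = e' := by
  have of_mem : ∀ e e' x, e.1 = e'.1 → x ∈ P e → x ∈ φ.cover.rotationHull P e' → e = e' := by
    rintro e e' x hee' hx (hx' | hx' | hx')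
    · exact hfree e e' x hee' hx hx'
    · exact absurd hx' (hexcl e e' x hee' hx)
    · refine absurd ?_ (hexcl _ (φ.cover.next (φ.cover.next e)) _
        (congrArg (fun d => M.next (M.next d)) hee'.symm) hx')
      rwa [next_next_next, permute_finRotate_three]
  have hnext : (φ.cover.next e).1 = (φ.cover.next e').1 := congrArg M.next hee'
  have next_injective : φ.cover.next.Injective :=
    φ.cover.cw.injective.comp φ.cover.rev.injective
  have hx'₁ := permute_finRotate_mem_rotationHull.2 hx'
  have hx'₂ := permute_finRotate_mem_rotationHull.2 hx'₁
  rcases hx with hx | hx | hx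
  · exact of_mem _ _ _ hee' hx hx'
  · exact next_injective (of_mem _ _ _ hnext hx hx'₁)
  · exact next_injective (next_injective (of_mem _ _ _ (congrArg M.next hnext) hx hx'₂))

theorem exists_nhds_disjoint (hopen : ∀ e, IsOpen (P e))
    (hedge : ∀ e x, x.1 2 = 0 → (x ∈ φ.cover.rotationHull P e ↔
      permute (Equiv.swap 0 1) x ∈ φ.cover.rotationHull P (φ.cover.rev e)))
    (hfree : ∀ e e' x, e.1 = e'.1 → x ∈ P e → x ∈ P e' → e = e')
    (hexcl : ∀ e e' x, e.1 = e'.1 → x ∈ P e → permute (finRotate 3) x ∉ P (φ.cover.next e'))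
    {e : D × G} {x : stdSimplex ℝ (Fin 3)} (hx : x ∈ φ.cover.rotationHull P e) :
    ∃ U ∈ 𝓝 (φ.cover.toRealization e x), ∀ g : G, ((g • ·) '' U ∩ U).Nonempty → g = 1 := by
  refine ⟨region P hedge, IsOpen.mem_nhds (Realization.isOpen_iff.2 fun e =>
    isOpen_rotationHull hopen e) hx, ?_⟩
  rintro g ⟨_, ⟨q, hq, rfl⟩, hgq⟩
  induction q using Realization.ind with | _ e y => ?_
  have heq : e = (e.1, g * e.2) := φ.eq_of_mem_rotationHull hfree hexcl rfl hq hgq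
  exact mul_eq_right.1 (congrArg Prod.snd heq).symm

theorem exists_nhds_disjoint_of_forall_pos {e : D × G} {x : stdSimplex ℝ (Fin 3)}
    (hx : ∀ i, 0 < x.1 i) :
    ∃ U ∈ 𝓝 (φ.cover.toRealization e x), ∀ g : G, ((g • ·) '' U ∩ U).Nonempty → g = 1 := by
  refine φ.exists_nhds_disjoint (P := fun e' => {y | e' = e ∧ ∀ i, 0 < y.1 i}) (fun e' => ?_)
    (fun e' y hy => ?_) (fun e₁ e₂ y _ h₁ h₂ => h₁.1.trans h₂.1.symm)
    (fun e₁ e₂ y h h₁ h₂ => ?_) (.inl ⟨rfl, hx⟩)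
  · simp only [Set.ofPred_and, Set.ofPred_forall]
    exact isOpen_const.inter <| isOpen_iInter_of_finite fun i =>
      isOpen_lt continuous_const (continuous_coord i)
  · simp [rotationHull, permute, Equiv.swap_apply_def, Fin.forall_fin_succ, hy]
  · exact M.next_ne e₁.1 ((congrArg M.next h).trans (congrArg Prod.fst (h₂.1.trans h₁.1.symm)))

/- Around an interior point of an edge, take the part of the two adjacent triangles where the
coordinate of the opposite corner is the smallest one. -/
theorem exists_nhds_disjoint_of_pos_of_pos {e : D × G} {x : stdSimplex ℝ (Fin 3)}
    (h₀ : 0 < x.1 0) (h₁ : 0 < x.1 1) (h₂ : x.1 2 = 0) :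
    ∃ U ∈ 𝓝 (φ.cover.toRealization e x), ∀ g : G, ((g • ·) '' U ∩ U).Nonempty → g = 1 := by
  refine φ.exists_nhds_disjoint
    (P := fun e' => {y | (e' = e ∨ e' = φ.cover.rev e) ∧ y.1 2 < y.1 0 ∧ y.1 2 < y.1 1})
    (fun e' => ?_) (fun e' y hy => ?_) (fun e₁ e₂ y h hy hy' => ?_) (fun e₁ e₂ y _ hy hy' => ?_)
    (.inl ⟨.inl rfl, by rwa [h₂], by rwa [h₂]⟩)
  · exact isOpen_const.and <| (isOpen_lt (continuous_coord 2) (continuous_coord 0)).and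
      (isOpen_lt (continuous_coord 2) (continuous_coord 1))
  · have rev_eq : φ.cover.rev e' = e ↔ e' = φ.cover.rev e :=
      Function.Involutive.eq_iff φ.cover.rev_rev
    have not_neg (i : Fin 3) : ¬ y.1 i < 0 := (y.2.1 i).not_gt
    simp [rotationHull, permute, Equiv.swap_apply_def, hy, not_neg, rev_eq, or_comm, and_comm]
  · have := M.rev_ne e.1
    simp only [Set.mem_ofPred_eq, cover_rev, Prod.ext_iff] at *
    grind
  · have hlt : y.1 0 < y.1 2 := hy'.2.2
    exact hlt.not_gt hy.2.1

/- Around a point close to a vertex, take the corners at all the vertices of the same sheet. -/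
theorem exists_nhds_disjoint_of_half_lt {e : D × G} {x : stdSimplex ℝ (Fin 3)}
    (hx : 1 / 2 < x.1 0) :
    ∃ U ∈ 𝓝 (φ.cover.toRealization e x), ∀ g : G, ((g • ·) '' U ∩ U).Nonempty → g = 1 := by
  refine φ.exists_nhds_disjoint (P := fun e' => {y | e'.2 = e.2 ∧ 1 / 2 < y.1 0})
    (fun e' => isOpen_const.and (isOpen_lt continuous_const (continuous_coord 0)))
    (fun e' y hy => ?_) (fun e₁ e₂ y h hy hy' => Prod.ext h (hy.1.trans hy'.1.symm))
    (fun e₁ e₂ y _ hy hy' => ?_) (.inl ⟨rfl, hx⟩)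
  · have not_half_lt : ¬ (2 : ℝ)⁻¹ < 0 := by norm_num
    simp [rotationHull, permute, Equiv.swap_apply_def, cover_rev, cover_next, hy, not_half_lt,
      or_comm]
  · have hlt : 1 / 2 < y.1 1 := hy'.2
    linarith [coord_sum y, y.2.1 2, hy.2]

end Disjoint

theorem isQuotientCoveringMap_proj : IsQuotientCoveringMap φ.proj G where
  __ := φ.isQuotientMap_proj
  continuous_const_smul := continuous_const_smul
  apply_eq_iff_mem_orbit := φ.proj_eq_proj_iff
  disjoint q := by
    obtain ⟨e, x, rfl, hx | hx⟩ := q.exists_forall_pos_or_eq_zero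
    · exact φ.exists_nhds_disjoint_of_forall_pos hx
    rcases (x.2.1 0).eq_or_lt' with h₀ | h₀
    · rw [toRealization_edge e hx]
      refine φ.exists_nhds_disjoint_of_half_lt ?_
      linarith [coord_sum x, (permute_swap_coord x).1]
    rcases (x.2.1 1).eq_or_lt' with h₁ | h₁
    · refine φ.exists_nhds_disjoint_of_half_lt ?_
      linarith [coord_sum x]
    · exact φ.exists_nhds_disjoint_of_pos_of_pos h₀ h₁ hx

end Cocycle

end Cover

namespace Cocycle

variable {D : Type*} {M : OrientedTriangulation D} {G : Type*} [Group G] (φ : M.Cocycle G)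

theorem exists_lift {u v : M.Vertex} (W : M.Walk u v) (g : G) :
    ∃ Γ : Path (φ.cover.vertexPoint (φ.coverVertex u g))
      (φ.cover.vertexPoint (φ.coverVertex v (g * ((Walk.darts W).map φ).prod))),
      ∀ t, φ.proj (Γ t) = Walk.toPath W t := by
  induction W with
  | nil =>
    refine ⟨(Path.refl _).cast rfl (by simp [Walk.darts]), fun t => ?_⟩
    exact Quotient.inductionOn u fun _ => rfl
  | cons W e ih =>
    obtain ⟨Γ, hΓ⟩ := ih
    obtain ⟨d, rfl, rfl⟩ := e
    refine ⟨(Γ.trans ((φ.cover.dartPath (d, g * ((Walk.darts W).map φ).prod)).cast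
      (congrArg _ (φ.src_cover ..).symm) rfl)).cast rfl
      (by simp [Walk.darts, tgt_cover, mul_assoc]), fun t => ?_⟩
    change φ.proj ((Γ.trans _) t) = ((Walk.toPath W).trans _) t
    rw [Path.trans_apply, Path.trans_apply]
    split_ifs
    · exact hΓ _
    · rfl

theorem prod_map_eq_of_homotopic {u v : M.Vertex} {W₁ W₂ : M.Walk u v}
    (h : (Walk.toPath W₁).Homotopic (Walk.toPath W₂)) :
    ((Walk.darts W₁).map φ).prod = ((Walk.darts W₂).map φ).prod := by
  have hproj := φ.isQuotientCoveringMap_proj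
  have := hproj.isCancelSMul
  obtain ⟨Γ₁, hΓ₁⟩ := φ.exists_lift W₁ 1
  obtain ⟨Γ₂, hΓ₂⟩ := φ.exists_lift W₂ 1
  have htarget :=
    target_eq_of_isCoveringMap_of_homotopic hproj.isCoveringMap h Γ₁ Γ₂ hΓ₁ hΓ₂
  have sheet (g : G) : φ.cover.vertexPoint (φ.coverVertex v (1 * g)) =
      g • φ.cover.vertexPoint (φ.coverVertex v 1) := by
    rw [smul_vertexPoint, one_mul, mul_one]
  rw [sheet, sheet] at htarget
  exact IsCancelSMul.right_cancel _ _ _ htarget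

end Cocycle

/-! ### Homotopies of walks -/

section Walks

variable {D : Type*} {M : OrientedTriangulation D}

namespace Walk

theorem darts_injective {u v : M.Vertex} : (darts : M.Walk u v → List D).Injective := by
  intro W W' h
  induction W with
  | nil =>
    cases W' with
    | nil => rfl
    | cons _ _ => exact absurd h (by simp [darts])
  | cons W e ih =>
    cases W' with
    | nil => exact absurd h (by simp [darts])
    | cons W' e' =>
      obtain ⟨hinit, hlast⟩ := List.append_inj' h rfl
      obtain ⟨d, hsrc, htgt⟩ := e
      obtain ⟨d', hsrc', htgt'⟩ := e'
      obtain rfl : d = d' := by simpa using hlast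
      obtain rfl := hsrc.symm.trans hsrc'
      rw [ih hinit]

theorem darts_comp {u v w : M.Vertex} (W : M.Walk u v) (W' : M.Walk v w) :
    darts (W.comp W') = darts W ++ darts W' := by
  induction W' with
  | nil => exact (List.append_nil _).symm
  | cons W' e ih => rw [Quiver.Path.comp_cons, darts, darts, ih, List.append_assoc]

theorem exists_comp_of_darts_eq_append {u v : M.Vertex} (W : M.Walk u v) {l l' : List D}
    (h : darts W = l ++ l') : ∃ (w : M.Vertex) (W₁ : M.Walk u w) (W₂ : M.Walk w v),
      W = W₁.comp W₂ ∧ darts W₁ = l ∧ darts W₂ = l' := by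
  induction W generalizing l' with
  | nil =>
    obtain ⟨rfl, rfl⟩ := List.append_eq_nil_iff.1 h.symm
    exact ⟨_, .nil, .nil, rfl, rfl, rfl⟩
  | cons W e ih =>
    rcases List.eq_nil_or_concat l' with rfl | ⟨l', a, rfl⟩
    · exact ⟨_, .cons W e, .nil, rfl, by simpa using h, rfl⟩
    · rw [List.concat_eq_append, ← List.append_assoc] at h
      obtain ⟨hinit, hlast⟩ := List.append_inj' h rfl
      obtain ⟨w, W₁, W₂, rfl, h₁, h₂⟩ := ih hinit
      exact ⟨w, W₁, .cons W₂ e, rfl, h₁, by rw [darts, h₂, hlast, List.concat_eq_append]⟩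

theorem exists_of_darts_eq_singleton {u v : M.Vertex} (W : M.Walk u v) {a : D}
    (h : darts W = [a]) : ∃ f : u ⟶ v, W = f.toPath ∧ f.1 = a := by
  rcases W with _ | ⟨_ | ⟨W, e⟩, f⟩
  · simp [darts] at h
  · exact ⟨f, rfl, by simpa [darts] using h⟩
  · have := congrArg List.length h
    simp [darts] at this

theorem exists_of_darts_eq_pair {u v : M.Vertex} (W : M.Walk u v) {a b : D}
    (h : darts W = [a, b]) : ∃ (w : M.Vertex) (f : u ⟶ w) (g : w ⟶ v),
      W = f.toPath.cons g ∧ f.1 = a ∧ g.1 = b := by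
  obtain ⟨w, W₁, W₂, rfl, h₁, h₂⟩ := W.exists_comp_of_darts_eq_append (l := [a]) (l' := [b]) h
  obtain ⟨f, rfl, hf⟩ := exists_of_darts_eq_singleton W₁ h₁
  obtain ⟨g, rfl, hg⟩ := exists_of_darts_eq_singleton W₂ h₂
  exact ⟨w, f, g, rfl, hf, hg⟩

/-- Two walks are homotopic in the realization, with fixed endpoints. -/
def Homotopic {u v : M.Vertex} (W W' : M.Walk u v) : Prop := (toPath W).Homotopic (toPath W')

theorem toPath_comp {u v w : M.Vertex} (W : M.Walk u v) (W' : M.Walk v w) :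
    (toPath (W.comp W')).Homotopic ((toPath W).trans (toPath W')) := by
  induction W' with
  | nil => exact (Path.Homotopic.trans_refl _).symm
  | cons W' e ih => exact (ih.hcomp (.refl _)).trans (.trans_assoc ..)

theorem Homotopic.comp {u v w : M.Vertex} {W₁ W₂ : M.Walk u v} {W₁' W₂' : M.Walk v w}
    (h : Homotopic W₁ W₂) (h' : Homotopic W₁' W₂') : Homotopic (W₁.comp W₁') (W₂.comp W₂') :=
  ((toPath_comp ..).trans (h.hcomp h')).trans (toPath_comp ..).symm

theorem toPath_toPath {u v : M.Vertex} (f : u ⟶ v) :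
    (toPath f.toPath).Homotopic ((M.dartPath f.1).cast
      (congrArg M.vertexPoint f.2.1.symm) (congrArg M.vertexPoint f.2.2.symm)) :=
  Path.Homotopic.refl_trans _

theorem homotopic_spur {u v : M.Vertex} (f : u ⟶ v) (g : v ⟶ u) (h : g.1 = M.rev f.1) :
    Homotopic (f.toPath.cons g) .nil := by
  obtain ⟨d, rfl, rfl⟩ := f
  obtain ⟨_, hsrc, htgt⟩ := g
  obtain rfl := h
  have hsymm : (M.dartPath (M.rev d)).cast (congrArg M.vertexPoint hsrc.symm)
      (congrArg M.vertexPoint htgt.symm) = (M.dartPath d).symm := by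
    ext t
    have := M.toRealization_rev d (unitInterval.symm t)
    rw [unitInterval.symm_symm] at this
    exact this.symm
  refine ((toPath_toPath _).hcomp (.refl _)).trans ?_
  rw [hsymm]
  exact .trans_symm _

end Walk

/-- The first side of the triangle, as a path. -/
def sidePath : Path (sidePoint 0) (sidePoint 1) where
  toFun := sidePoint
  continuous_toFun := continuous_sidePoint
  source' := rfl
  target' := rfl

theorem permute_finRotate_sidePoint_one : permute (finRotate 3) (sidePoint 1) = sidePoint 0 := by
  refine Subtype.ext (funext fun i => ?_)
  fin_cases i <;> simp [permute, sidePoint]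

theorem Walk.homotopic_triangle {u v w : M.Vertex} (f : u ⟶ v) (g : v ⟶ w) (k : u ⟶ w)
    (hg : g.1 = M.next f.1) (hk : k.1 = M.rev (M.next (M.next f.1))) :
    Homotopic (f.toPath.cons g) k.toPath := by
  obtain ⟨d, hsrc, htgt⟩ := f
  obtain ⟨_, hg₁, hg₂⟩ := g
  obtain ⟨_, hk₁, hk₂⟩ := k
  dsimp only at hg hk
  subst hg hk
  have rotation := continuous_permute (finRotate 3)
  have h₁ : sidePoint 1 = permute (finRotate 3) (permute (finRotate 3) (sidePoint 0)) := by
    rw [← permute_finRotate_sidePoint_one, permute_finRotate_three]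
  refine ((toPath_toPath _).hcomp (.refl _)).trans (.trans ?_ (toPath_toPath _).symm)
  refine trans_homotopic_of_simplyConnectedSpace (M.continuous_toRealization d) sidePath
    ((((sidePath.map rotation).map rotation).cast h₁
      (congrArg _ permute_finRotate_sidePoint_one.symm)))
    ((sidePath.map rotation).symm.cast permute_finRotate_sidePoint_one.symm rfl)
    (fun _ => rfl) (fun t => ?_) (fun t => ?_)
  · have := (M.toRealization_rotate (M.next d) (sidePoint t)).trans (toRealization_rotate ..)
    rw [next_next_next] at this
    exact this.symm
  · have := M.toRealization_rev (M.next (M.next d)) (unitInterval.symm t)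
    rw [unitInterval.symm_symm, toRealization_rotate, next_next_next] at this
    exact this

end Walks

section Existence

variable {D : Type*} {M : OrientedTriangulation D} {color : D → TriangleColor}

variable (M) in
/-- Every walk along the word `l` is homotopic to a walk along the word `l'`. -/
def Replaceable (l l' : List D) : Prop :=
  ∀ ⦃u v : M.Vertex⦄ (W : M.Walk u v), Walk.darts W = l →
    ∃ W' : M.Walk u v, Walk.darts W' = l' ∧ Walk.Homotopic W W'

namespace Replaceable

theorem refl (l : List D) : M.Replaceable l l := fun _ _ W h => ⟨W, h, .refl _⟩

theorem trans {l₁ l₂ l₃ : List D} (h : M.Replaceable l₁ l₂) (h' : M.Replaceable l₂ l₃) :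
    M.Replaceable l₁ l₃ := fun _ _ W hW => by
  obtain ⟨W', hW', hom⟩ := h W hW
  obtain ⟨W'', hW'', hom'⟩ := h' W' hW'
  exact ⟨W'', hW'', hom.trans hom'⟩

theorem append {l₁ l₂ l₁' l₂' : List D} (h : M.Replaceable l₁ l₂) (h' : M.Replaceable l₁' l₂') :
    M.Replaceable (l₁ ++ l₁') (l₂ ++ l₂') := fun _ _ W hW => by
  obtain ⟨w, W₁, W₂, rfl, h₁, h₂⟩ := W.exists_comp_of_darts_eq_append hW
  obtain ⟨W₁', h₁', hom₁⟩ := h W₁ h₁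
  obtain ⟨W₂', h₂', hom₂⟩ := h' W₂ h₂
  exact ⟨_, by rw [Walk.darts_comp, h₁', h₂'], hom₁.comp hom₂⟩

theorem reverse {l l' : List D} (h : M.Replaceable l' l)
    (hwalk : ∀ ⦃u v : M.Vertex⦄ (W : M.Walk u v), Walk.darts W = l →
      ∃ W' : M.Walk u v, Walk.darts W' = l') : M.Replaceable l l' := fun _ _ W hW => by
  obtain ⟨W', hW'⟩ := hwalk W hW
  obtain ⟨W'', hW'', hom⟩ := h W' hW'
  obtain rfl : W = W'' := Walk.darts_injective (hW.trans hW''.symm)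
  exact ⟨W', hW', hom.symm⟩

theorem spur (a : D) : M.Replaceable [a, M.rev a] [] := fun u v W hW => by
  obtain ⟨w, f, g, rfl, hf, hg⟩ := W.exists_of_darts_eq_pair hW
  obtain rfl : v = u := by rw [← g.2.2, ← f.2.1, hf, hg, tgt_rev]
  exact ⟨.nil, rfl, Walk.homotopic_spur f g (by rw [hf, hg])⟩

theorem contractLeft (a : D) : M.Replaceable [a, M.next a] [M.rev (M.next (M.next a))] :=
  fun u v W hW => by
  obtain ⟨w, f, g, rfl, hf, hg⟩ := W.exists_of_darts_eq_pair hW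
  let k : u ⟶ v := ⟨M.rev (M.next (M.next a)),
    by rw [← tgt, tgt_next_next, ← f.2.1, hf], by rw [tgt_rev, src_next, ← g.2.2, hg]⟩
  exact ⟨k.toPath, rfl, Walk.homotopic_triangle f g k (by rw [hf, hg]) (by rw [hf])⟩

theorem expandRight (a : D) : M.Replaceable [a] [M.next (M.rev a), M.next (M.next (M.rev a))] := by
  refine reverse (by simpa using contractLeft (M := M) (M.next (M.rev a))) fun u v W hW => ?_
  obtain ⟨f, -, rfl⟩ := W.exists_of_darts_eq_singleton hW
  let g : u ⟶ M.tgt (M.next (M.rev f.1)) :=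
    ⟨M.next (M.rev f.1), by rw [src_next, tgt_rev, f.2.1], rfl⟩
  let k : M.tgt (M.next (M.rev f.1)) ⟶ v :=
    ⟨M.next (M.next (M.rev f.1)), src_next .., by rw [tgt_next_next, ← tgt, f.2.2]⟩
  exact ⟨g.toPath.cons k, rfl⟩

theorem contractRight (a : D) :
    M.Replaceable [a, M.rev (M.next (M.next (M.rev a)))] [M.next (M.rev a)] := by
  exact ((expandRight a).append (refl [M.rev (M.next (M.next (M.rev a)))])).trans
    ((refl [M.next (M.rev a)]).append (spur (M.next (M.next (M.rev a)))))

theorem expandLeft (a : D) : M.Replaceable [a] [M.rev (M.next (M.next a)), M.rev (M.next a)] := by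
  refine reverse (by simpa using contractRight (M := M) (M.rev (M.next (M.next a))))
    fun u v W hW => ?_
  obtain ⟨f, -, rfl⟩ := W.exists_of_darts_eq_singleton hW
  let g : u ⟶ M.src (M.next (M.next f.1)) :=
    ⟨M.rev (M.next (M.next f.1)), by rw [← tgt, tgt_next_next, f.2.1], tgt_rev ..⟩
  let k : M.src (M.next (M.next f.1)) ⟶ v :=
    ⟨M.rev (M.next f.1), (src_next ..).symm, by rw [tgt_rev, src_next, f.2.2]⟩
  exact ⟨g.toPath.cons k, rfl⟩

/- A `2`-turn is shortened by replacing each of the two darts by the other sides of its inner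
triangle: both replacements use the side shared by the two triangles, in opposite directions. -/
theorem of_shortcut {a b : D} {k : ℤ} {m : List D} (h : M.Shortcut color a b k m) :
    M.Replaceable [a, b] m := by
  cases h with
  | spur hb =>
    subst hb
    exact spur a
  | left hb =>
    subst hb
    exact contractLeft a
  | right hb =>
    subst hb
    exact contractRight a
  | flipLeft _ hb =>
    subst hb
    refine ((expandLeft a).append (expandLeft (M.next (M.rev (M.next a))))).trans ?_
    simpa using ((refl (M := M) [M.rev (M.next (M.next a))]).append
      (spur (M.rev (M.next a)))).append (refl [M.rev (M.next (M.next (M.rev (M.next a))))])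
  | flipRight _ hb =>
    subst hb
    refine ((expandRight a).append (expandRight _)).trans ?_
    simpa using ((refl (M := M) [M.next (M.rev a)]).append
      (spur (M.next (M.next (M.rev a))))).append (refl [M.next (M.rev (M.next (M.next (M.rev a))))])

theorem of_step {l l' : List D} (h : M.Step color l l') : M.Replaceable l l' := by
  induction h with
  | head l h => exact (of_shortcut h).append (refl l)
  | cons a _ ih => exact (refl [a]).append ih

end Replaceable

theorem Walk.isReduced_of_irreducible {u v : M.Vertex} {W : M.Walk u v}
    (h : ∀ l, ¬ M.Step color (darts W) l) : IsReduced color W :=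
  ((isChain_not_shortcut_iff _).2 h).imp fun _ _ hab hbad => hab hbad.exists_shortcut

theorem Walk.IsReduced.irreducible (hdeg : ∀ v, 3 ≤ M.degree v) {u v : M.Vertex} {W : M.Walk u v}
    (h : IsReduced color W) : ∀ l, ¬ M.Step color (darts W) l :=
  (isChain_not_shortcut_iff _).1 <|
    List.IsChain.imp (fun _ _ hgood ⟨_, _, hab⟩ => hgood (hab.isBadTurn (hdeg _))) h

theorem exists_isReduced_homotopic (hM : M.IsDualColoring color) {u v : M.Vertex}
    (W : M.Walk u v) : ∃ W' : M.Walk u v, Walk.IsReduced color W' ∧ Walk.Homotopic W W' := by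
  generalize hl : Walk.darts W = l
  induction l using (Step.wellFounded hM).induction generalizing W with
  | _ l ih =>
    by_cases h : ∃ l', M.Step color l l'
    · obtain ⟨l', hstep⟩ := h
      obtain ⟨W', hW', hom⟩ := Replaceable.of_step hstep W hl
      obtain ⟨W'', hW'', hom'⟩ := ih l' hstep W' hW'
      exact ⟨W'', hW'', hom.trans hom'⟩
    · exact ⟨W, Walk.isReduced_of_irreducible fun l' hl' => h ⟨l', hl ▸ hl'⟩, .refl _⟩

theorem Walk.IsReduced.eq_of_homotopic (hM : M.IsDualColoring color)
    (hdeg : ∀ v, 5 ≤ M.degree v) {u v : M.Vertex} {W₁ W₂ : M.Walk u v} (h₁ : IsReduced color W₁)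
    (h₂ : IsReduced color W₂) (h : Homotopic W₁ W₂) : W₁ = W₂ := by
  have hdeg' (v : M.Vertex) : 3 ≤ M.degree v := le_trans (by norm_num) (hdeg v)
  have heqv : Relation.EqvGen (M.Step color) (darts W₁) (darts W₂) :=
    (M.prod_map_universalCocycle_eq_iff color).1 (Cocycle.prod_map_eq_of_homotopic _ h)
  exact darts_injective <| eq_of_eqvGen_of_irreducible (Step.wellFounded hM)
    (Step.locallyConfluent hM hdeg) heqv (h₁.irreducible hdeg') (h₂.irreducible hdeg')

end Existence

end OrientedTriangulation

theorem SurfaceTriangulation.homotopic_iff {D S : Type*} [TopologicalSpace S]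
    (T : SurfaceTriangulation D S) {u v : T.Vertex} (W₁ W₂ : T.Walk u v) :
    T.Homotopic W₁ W₂ ↔ OrientedTriangulation.Walk.Homotopic W₁ W₂ := by
  refine ⟨fun h => ?_, fun h => h.map ⟨_, T.homeo.continuous⟩⟩
  have hpath (W : T.Walk u v) : ((T.walkPath W).map T.homeo.symm.continuous).cast
      (T.homeo.symm_apply_apply _).symm (T.homeo.symm_apply_apply _).symm =
      OrientedTriangulation.Walk.toPath W :=
    Path.ext (funext fun t => T.homeo.symm_apply_apply _)
  rw [OrientedTriangulation.Walk.Homotopic, ← hpath W₁, ← hpath W₂]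
  exact (Path.Homotopic.map h ⟨_, T.homeo.symm.continuous⟩).pathCast _ _

theorem mainTheorem4_general {D S : Type*} [TopologicalSpace S] (T : SurfaceTriangulation D S)
    (color : D → TriangleColor) (hcolor : T.IsDualColoring color) (hdeg : ∀ v, 5 ≤ T.degree v) :
    (∀ (u v : T.Vertex) (W₁ W₂ : T.Walk u v),
      OrientedTriangulation.Walk.IsReduced color W₁ →
      OrientedTriangulation.Walk.IsReduced color W₂ →
      T.Homotopic W₁ W₂ → W₁ = W₂) ∧
    (∀ (u v : T.Vertex) (W : T.Walk u v),
      ∃! W' : T.Walk u v,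
        OrientedTriangulation.Walk.IsReduced color W' ∧ T.Homotopic W W') := by
  have unique (u v : T.Vertex) (W₁ W₂ : T.Walk u v)
      (h₁ : OrientedTriangulation.Walk.IsReduced color W₁)
      (h₂ : OrientedTriangulation.Walk.IsReduced color W₂) (h : T.Homotopic W₁ W₂) : W₁ = W₂ :=
    h₁.eq_of_homotopic hcolor hdeg h₂ ((T.homotopic_iff W₁ W₂).1 h)
  refine ⟨unique, fun u v W => ?_⟩
  obtain ⟨W', hW', hom⟩ := OrientedTriangulation.exists_isReduced_homotopic hcolor W
  have hom' : T.Homotopic W W' := (T.homotopic_iff W W').2 hom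
  exact ⟨W', ⟨hW', hom'⟩, fun W'' ⟨hW'', hom''⟩ =>
    unique u v W'' W' hW'' hW' (hom''.symm.trans hom')⟩

theorem mainTheorem4 {D S : Type*} [TopologicalSpace S] (T : SurfaceTriangulation D S)
    (color : D → TriangleColor) (hT : T.IsReducing color) :
    (∀ (u v : T.Vertex) (W₁ W₂ : T.Walk u v),
      OrientedTriangulation.Walk.IsReduced color W₁ →
      OrientedTriangulation.Walk.IsReduced color W₂ →
      T.Homotopic W₁ W₂ → W₁ = W₂) ∧
    (∀ (u v : T.Vertex) (W : T.Walk u v),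
      ∃! W' : T.Walk u v,
        OrientedTriangulation.Walk.IsReduced color W' ∧ T.Homotopic W W') :=
  mainTheorem4_general T color hT.coloring fun v => le_trans (by norm_num) (hT.eight_le_degree v)
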